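/- Consider the Picard-type iteration on $[0,\infty)$ given by $f_1(x)=x$ and, for $n\ge 1$, $f_{n+1}'(x)=\exp(f_n^{-1}(x))$ for $x\ge 0$, $f_{n+1}(0)=0$, where $f_n^{-1}$ is the compositional inverse of $f_n:[0,\infty)\to[0,\infty)$ and derivatives at $0$ are right derivatives. This iteration is well defined and determines the functions $f_n$ uniquely; each $f_n$ is a strictly increasing, convex, $C^\infty$ bijection of $[0,\infty)$ onto itself. For every $x\ge 0$ the sequence $(f_{2k-1}(x))_{k\ge 1}$ is nondecreasing and $(f_{2k}(x))_{k\ge 1}$ is nonincreasing, and $f_{2k-1}(x)<f_{2k}(x)$ for all $k\ge 1$ and $x>0$. There are functions $f_-,f_+:[0,\infty)\to[0,\infty)$ such that $f_{2k-1}\to f_-$ and $f_{2k}\to f_+$ as $k\to\infty$, locally uniformly on $[0,\infty)$ and moreover locally in $C^\infty$ (that is, for every $m\ge 0$ the $m$-th derivatives converge locally uniformly on $[0,\infty)$). Both $f_-$ and $f_+$ are $C^\infty$, strictly increasing and convex bijections of $[0,\infty)$ onto itself, and $f_-\le f_+$. They satisfy $$f_+'=\exp(f_-^{-1}),\qquad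 f_-'=\exp(f_+^{-1}),\qquad f_\pm(0)=0$$ on $[0,\infty)$, so they form an orbit of order at most $2$ of the iteration. Finally, there is exactly one formal power series $F=\sum_{m\ge 0}a_mX^m\in\mathbb R[[X]]$ with $a_0=0$ that has a compositional inverse $F^{-1}$ and satisfies $F'=\exp(F^{-1})$ formally, and $$\frac{f_-^{(m)}(0)}{m!}=\frac{f_+^{(m)}(0)}{m!}=a_m\qquad\text{for all } m\ge 0 .$$ -/

import Mathlib

open Set Filter Topology
open scoped ContDiff

/-- The compositional inverse of a function `f` that restricts to a bijection of `[0, ∞)` onto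
itself; only its values on `[0, ∞)` are meaningful. -/
noncomputable def inverseOnNonneg (f : ℝ → ℝ) : ℝ → ℝ :=
  Function.invFunOn f (Ici 0)

/-- On `[0, ∞)`, the function `g` solves `g' = exp (f⁻¹)` with `g 0 = 0` (the derivative at `0` is
the right derivative). -/
def IsPicardImage (f g : ℝ → ℝ) : Prop :=
  g 0 = 0 ∧
    ∀ x ∈ Ici (0 : ℝ), HasDerivWithinAt g (Real.exp (inverseOnNonneg f x)) (Ici 0) x

/-- The Picard-type iteration on `[0, ∞)`: `f₁ = x`, `fₙ₊₁' = exp (fₙ⁻¹)`, `fₙ₊₁ 0 = 0`, `n ≥ 1`.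
Only the indices `n ≥ 1` and the values on `[0, ∞)` are used. -/
def IsPicardIteration (f : ℕ → ℝ → ℝ) : Prop :=
  (∀ x ∈ Ici (0 : ℝ), f 1 x = x) ∧ ∀ n ≥ 1, IsPicardImage (f n) (f (n + 1))

/-- `G` is the compositional inverse of `F`; both series have constant term zero, so that the
substitutions are meaningful. -/
def IsCompInverse (F G : PowerSeries ℝ) : Prop :=
  PowerSeries.constantCoeff F = 0 ∧ PowerSeries.constantCoeff G = 0 ∧
    PowerSeries.subst G F = PowerSeries.X ∧ PowerSeries.subst F G = PowerSeries.X

/-- `F` is a formal power series with `F(0) = 0` which has a compositional inverse and satisfies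
`F' = exp (F⁻¹)`. -/
def IsFormalSolution (F : PowerSeries ℝ) : Prop :=
  ∃ G : PowerSeries ℝ, IsCompInverse F G ∧
    PowerSeries.derivative ℝ F = PowerSeries.subst G (PowerSeries.exp ℝ)

/-- Convergence of `u k` to `g` locally in `C^∞` on `[0, ∞)`: the derivatives of every order
(including order zero) converge locally uniformly. -/
def TendstoLocallySmooth (u : ℕ → ℝ → ℝ) (g : ℝ → ℝ) : Prop :=
  (∀ k, ContDiffOn ℝ ∞ (u k) (Ici 0)) ∧ ContDiffOn ℝ ∞ g (Ici 0) ∧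
    ∀ m : ℕ, TendstoLocallyUniformlyOn (fun k => iteratedDerivWithin m (u k) (Ici 0))
      (iteratedDerivWithin m g (Ici 0)) atTop (Ici 0)

/-!
The iteration stays in the class of *admissible* functions: `f 0 = 0`, and the increments of `f`
on `[0, ∞)` lie between those of the identity and those of `exp`. An admissible function is a
bijection of `[0, ∞)` with `1`-Lipschitz inverse, and admissibility is closed under pointwise
limits.

The Picard step reverses the pointwise order (`IsPicardImage.anti`, `IsPicardImage.strictAnti`).
Since `f₁ < f₂` and `f₁ ≤ f₃`, induction gives the monotonicity of the odd and even subsequences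
and their ordering, hence pointwise limits `fm` and `fp`. Pointwise convergence passes to inverses
(`Admissible.tendsto_inverse`) and, by dominated convergence, through the Picard step
(`IsPicardImage.of_tendsto`), so `fm` and `fp` are Picard images of each other.

For smoothness and convergence of derivatives, a sequence and its limit are regarded as one family
over `ℕ∞`; locally uniform convergence is then joint continuity. The property `ParamContDiff m`
(derivatives up to order `m` in the space variable are jointly continuous) is stable under products,
composition and, thanks to `(f⁻¹)' = (f' ∘ f⁻¹)⁻¹`, inversion. As `g' = exp (f⁻¹)`, each Picard
step gains one derivative, and a bootstrap between the odd and the even family yields every order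
(`IsPicardIteration.paramContDiff`).

On the formal side, one Picard step improves the order of agreement of two power series by one
(`IsFormalPicardImage.X_pow_succ_dvd_sub`), so there is at most one formal orbit of order two
(`IsFormalPicardImage.orbit_unique`). Taking Taylor series at `0` commutes with derivatives,
products and compositions, so the Taylor series of `fm` and `fp` form such an orbit. Comparing it
with the orbit in which they are interchanged shows that they coincide; hence they are a formal
solution, and comparing with an arbitrary formal solution shows that it is the only one.
-/

/-! ### Admissible functions and their inverses -/

/-- The class of functions in which the iteration lives: on `[0, ∞)` they vanish at `0` and their
increments lie between those of the identity and those of `exp`. The condition passes to pointwise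
limits and makes the functions bijections of `[0, ∞)` with `1`-Lipschitz inverses. -/
def Admissible (f : ℝ → ℝ) : Prop :=
  f 0 = 0 ∧ ∀ x y : ℝ, 0 ≤ x → x ≤ y →
    y - x ≤ f y - f x ∧ f y - f x ≤ Real.exp y - Real.exp x

namespace Admissible

variable {f g : ℝ → ℝ}

theorem strictMonoOn (hf : Admissible f) : StrictMonoOn f (Ici 0) := by
  intro x hx y _ hxy
  have := (hf.2 x y hx hxy.le).1
  linarith

theorem le_apply (hf : Admissible f) {x : ℝ} (hx : 0 ≤ x) : x ≤ f x := by
  have := (hf.2 0 x le_rfl hx).1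
  rw [hf.1] at this
  linarith

theorem apply_nonneg (hf : Admissible f) {x : ℝ} (hx : 0 ≤ x) : 0 ≤ f x :=
  hx.trans (hf.le_apply hx)

theorem apply_le (hf : Admissible f) {x : ℝ} (hx : 0 ≤ x) : f x ≤ Real.exp x - 1 := by
  have := (hf.2 0 x le_rfl hx).2
  rw [hf.1, Real.exp_zero] at this
  linarith

theorem abs_sub_le (hf : Admissible f) {x y : ℝ} (hx : 0 ≤ x) (hy : 0 ≤ y) :
    |f y - f x| ≤ |Real.exp y - Real.exp x| := by
  rcases le_total x y with h | h
  · have := hf.2 x y hx h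
    rw [abs_of_nonneg (by linarith), abs_of_nonneg (by linarith)]
    exact this.2
  · have := hf.2 y x hy h
    rw [abs_of_nonpos (by linarith), abs_of_nonpos (by linarith)]
    linarith

theorem abs_le_sub (hf : Admissible f) {x y : ℝ} (hx : 0 ≤ x) (hy : 0 ≤ y) :
    |y - x| ≤ |f y - f x| := by
  rcases le_total x y with h | h
  · have := hf.2 x y hx h
    rw [abs_of_nonneg (by linarith), abs_of_nonneg (by linarith)]
    exact this.1
  · have := hf.2 y x hy h
    rw [abs_of_nonpos (by linarith), abs_of_nonpos (by linarith)]
    linarith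

theorem continuousOn (hf : Admissible f) : ContinuousOn f (Ici 0) := by
  intro x hx
  rw [ContinuousWithinAt, tendsto_iff_dist_tendsto_zero]
  have h : Tendsto (fun y => |Real.exp y - Real.exp x|) (𝓝[Ici 0] x) (𝓝 0) := by
    have : Continuous fun y => |Real.exp y - Real.exp x| := by fun_prop
    simpa using (this.tendsto x).mono_left nhdsWithin_le_nhds
  refine squeeze_zero' (.of_forall fun _ => dist_nonneg) ?_ h
  filter_upwards [self_mem_nhdsWithin] with y hy
  exact hf.abs_sub_le hx hy

theorem bijOn (hf : Admissible f) : BijOn f (Ici 0) (Ici 0) := by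
  refine ⟨fun x hx => hf.apply_nonneg hx, hf.strictMonoOn.injOn, fun y hy => ?_⟩
  have hc : ContinuousOn f (Icc 0 y) := hf.continuousOn.mono Icc_subset_Ici_self
  obtain ⟨x, hx, rfl⟩ := intermediate_value_Icc (mem_Ici.1 hy) hc
    ⟨by rw [hf.1]; exact hy, hf.le_apply hy⟩
  exact ⟨x, hx.1, rfl⟩

theorem inverse_nonneg (hf : Admissible f) {y : ℝ} (hy : 0 ≤ y) : 0 ≤ inverseOnNonneg f y :=
  Function.invFunOn_mem (hf.bijOn.surjOn hy)

theorem apply_inverse (hf : Admissible f) {y : ℝ} (hy : 0 ≤ y) : f (inverseOnNonneg f y) = y :=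
  Function.invFunOn_eq (hf.bijOn.surjOn hy)

theorem inverse_apply (hf : Admissible f) {x : ℝ} (hx : 0 ≤ x) : inverseOnNonneg f (f x) = x :=
  hf.bijOn.injOn.leftInvOn_invFunOn hx

theorem inverse_zero (hf : Admissible f) : inverseOnNonneg f 0 = 0 := by
  simpa [hf.1] using hf.inverse_apply le_rfl

theorem abs_inverse_sub_le (hf : Admissible f) {x y : ℝ} (hx : 0 ≤ x) (hy : 0 ≤ y) :
    |inverseOnNonneg f y - inverseOnNonneg f x| ≤ |y - x| := by
  have := hf.abs_le_sub (hf.inverse_nonneg hx) (hf.inverse_nonneg hy)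
  rwa [hf.apply_inverse hx, hf.apply_inverse hy] at this

theorem inverse_monotoneOn (hf : Admissible f) : MonotoneOn (inverseOnNonneg f) (Ici 0) := by
  intro x hx y hy hxy
  rw [← hf.strictMonoOn.le_iff_le (hf.inverse_nonneg hx) (hf.inverse_nonneg hy),
    hf.apply_inverse hx, hf.apply_inverse hy]
  exact hxy

theorem inverse_le_self (hf : Admissible f) {y : ℝ} (hy : 0 ≤ y) : inverseOnNonneg f y ≤ y := by
  simpa [hf.apply_inverse hy] using hf.le_apply (hf.inverse_nonneg hy)

theorem continuousOn_inverse (hf : Admissible f) : ContinuousOn (inverseOnNonneg f) (Ici 0) := by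
  have : LipschitzOnWith 1 (inverseOnNonneg f) (Ici 0) :=
    LipschitzOnWith.of_dist_le_mul fun x hx y hy => by
      simpa [Real.dist_eq] using hf.abs_inverse_sub_le hy hx
  exact this.continuousOn

theorem inverse_anti (hf : Admissible f) (hg : Admissible g) (h : ∀ x ∈ Ici (0 : ℝ), f x ≤ g x)
    {y : ℝ} (hy : 0 ≤ y) : inverseOnNonneg g y ≤ inverseOnNonneg f y := by
  rw [← hg.strictMonoOn.le_iff_le (hg.inverse_nonneg hy) (hf.inverse_nonneg hy),
    hg.apply_inverse hy]
  simpa [hf.apply_inverse hy] using h _ (hf.inverse_nonneg hy)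

theorem inverse_strictAnti (hf : Admissible f) (hg : Admissible g) (h : ∀ x > 0, f x < g x)
    {y : ℝ} (hy : 0 < y) : inverseOnNonneg g y < inverseOnNonneg f y := by
  rw [← hg.strictMonoOn.lt_iff_lt (hg.inverse_nonneg hy.le) (hf.inverse_nonneg hy.le),
    hg.apply_inverse hy.le]
  have hpos : 0 < inverseOnNonneg f y := by
    rw [← hf.strictMonoOn.lt_iff_lt self_mem_Ici (hf.inverse_nonneg hy.le),
      hf.apply_inverse hy.le, hf.1]
    exact hy
  simpa [hf.apply_inverse hy.le] using h _ hpos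

/-- Admissibility is a closed condition. -/
theorem of_tendsto {ι : Type*} {l : Filter ι} [l.NeBot] {u : ι → ℝ → ℝ}
    (hu : ∀ i, Admissible (u i)) (h : ∀ x ∈ Ici (0 : ℝ), Tendsto (fun i => u i x) l (𝓝 (f x))) :
    Admissible f := by
  refine ⟨?_, fun x y hx hxy => ⟨?_, ?_⟩⟩
  · refine tendsto_nhds_unique (h 0 self_mem_Ici) ?_
    simp [(hu _).1]
  · exact ge_of_tendsto' ((h y (hx.trans hxy)).sub (h x hx)) fun i => ((hu i).2 x y hx hxy).1
  · exact le_of_tendsto' ((h y (hx.trans hxy)).sub (h x hx)) fun i => ((hu i).2 x y hx hxy).2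

/-- Pointwise convergence passes to the inverses, because those are uniformly Lipschitz. -/
theorem tendsto_inverse {ι : Type*} {l : Filter ι} {u : ι → ℝ → ℝ}
    (hu : ∀ i, Admissible (u i)) (hf : Admissible f)
    (h : ∀ x ∈ Ici (0 : ℝ), Tendsto (fun i => u i x) l (𝓝 (f x))) {y : ℝ} (hy : 0 ≤ y) :
    Tendsto (fun i => inverseOnNonneg (u i) y) l (𝓝 (inverseOnNonneg f y)) := by
  rw [tendsto_iff_dist_tendsto_zero]
  have hx := hf.inverse_nonneg hy
  have h0 : Tendsto (fun i => |f (inverseOnNonneg f y) - u i (inverseOnNonneg f y)|) l (𝓝 0) := by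
    simpa using ((tendsto_const_nhds (x := f (inverseOnNonneg f y))).sub (h _ hx)).abs
  refine squeeze_zero (fun _ => dist_nonneg) (fun i => ?_) h0
  have := (hu i).abs_inverse_sub_le ((hu i).apply_nonneg hx) (hf.apply_nonneg hx)
  rw [(hu i).inverse_apply hx, hf.apply_inverse hy, ← Real.dist_eq] at this
  rwa [hf.apply_inverse hy]

end Admissible

/-! ### Derivatives and primitives on the half-line -/

theorem monotoneOn_Ici_of_hasDerivWithinAt {h d : ℝ → ℝ}
    (hd : ∀ x ∈ Ici (0 : ℝ), HasDerivWithinAt h (d x) (Ici 0) x) (hnn : ∀ x > 0, 0 ≤ d x) :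
    MonotoneOn h (Ici 0) := by
  refine monotoneOn_of_hasDerivWithinAt_nonneg (convex_Ici 0)
    (fun x hx => (hd x hx).continuousWithinAt) (f' := d) ?_ ?_
  · rw [interior_Ici]
    exact fun x hx => (hd x (mem_Ici.2 (le_of_lt hx))).mono Ioi_subset_Ici_self
  · rw [interior_Ici]
    exact hnn

theorem strictMonoOn_Ici_of_hasDerivWithinAt {h d : ℝ → ℝ}
    (hd : ∀ x ∈ Ici (0 : ℝ), HasDerivWithinAt h (d x) (Ici 0) x) (hpos : ∀ x > 0, 0 < d x) :
    StrictMonoOn h (Ici 0) := by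
  refine strictMonoOn_of_hasDerivWithinAt_pos (convex_Ici 0)
    (fun x hx => (hd x hx).continuousWithinAt) (f' := d) ?_ ?_
  · rw [interior_Ici]
    exact fun x hx => (hd x (mem_Ici.2 (le_of_lt hx))).mono Ioi_subset_Ici_self
  · rw [interior_Ici]
    exact hpos

/-- Truncating the integrand at `0` by `max s 0` makes it continuous on the whole line without
changing it on `[0, ∞)`. -/
theorem hasDerivWithinAt_primitive {h : ℝ → ℝ} (hh : ContinuousOn h (Ici 0)) {x : ℝ}
    (hx : 0 ≤ x) :
    HasDerivWithinAt (fun x => ∫ s in (0 : ℝ)..x, h (max s 0)) (h x) (Ici 0) x := by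
  have hc : Continuous fun s => h (max s 0) :=
    hh.comp_continuous (by fun_prop) fun s => le_max_right s 0
  have := (hc.integral_hasStrictDerivAt 0 x).hasDerivAt.hasDerivWithinAt (s := Ici 0)
  simpa [max_eq_left hx] using this

/-! ### The Picard step -/

theorem isPicardImage_integral {f : ℝ → ℝ} (hf : Admissible f) :
    IsPicardImage f fun x => ∫ s in (0 : ℝ)..x, Real.exp (inverseOnNonneg f (max s 0)) :=
  ⟨by simp, fun _ hx =>
    hasDerivWithinAt_primitive (h := fun s => Real.exp (inverseOnNonneg f s))
      (Real.continuous_exp.comp_continuousOn hf.continuousOn_inverse) hx⟩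

namespace IsPicardImage

variable {f g f₁ f₂ g₁ g₂ : ℝ → ℝ}

/-- A pointwise larger function has a pointwise smaller Picard image. -/
theorem anti (h₁ : IsPicardImage f₁ g₁) (h₂ : IsPicardImage f₂ g₂) (hf₁ : Admissible f₁)
    (hf₂ : Admissible f₂) (h : ∀ x ∈ Ici (0 : ℝ), f₁ x ≤ f₂ x) :
    ∀ x ∈ Ici (0 : ℝ), g₂ x ≤ g₁ x := by
  intro x hx
  have := monotoneOn_Ici_of_hasDerivWithinAt (fun x hx => (h₁.2 x hx).sub (h₂.2 x hx))
    (fun x hx => sub_nonneg.2 (Real.exp_le_exp.2 (hf₁.inverse_anti hf₂ h hx.le)))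
    self_mem_Ici hx hx
  simp only [Pi.sub_apply, h₁.1, h₂.1] at this
  linarith

theorem strictAnti (h₁ : IsPicardImage f₁ g₁) (h₂ : IsPicardImage f₂ g₂) (hf₁ : Admissible f₁)
    (hf₂ : Admissible f₂) (h : ∀ x > 0, f₁ x < f₂ x) : ∀ x > 0, g₂ x < g₁ x := by
  intro x hx
  have := strictMonoOn_Ici_of_hasDerivWithinAt (fun x hx => (h₁.2 x hx).sub (h₂.2 x hx))
    (fun x hx => sub_pos.2 (Real.exp_lt_exp.2 (hf₁.inverse_strictAnti hf₂ h hx)))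
    self_mem_Ici (mem_Ici.2 hx.le) hx
  simp only [Pi.sub_apply, h₁.1, h₂.1] at this
  linarith

theorem eqOn (h₁ : IsPicardImage f₁ g₁) (h₂ : IsPicardImage f₂ g₂) (hf₁ : Admissible f₁)
    (hf₂ : Admissible f₂) (h : EqOn f₁ f₂ (Ici 0)) : EqOn g₁ g₂ (Ici 0) := fun x hx =>
  le_antisymm (h₂.anti h₁ hf₂ hf₁ (fun _ hy => (h hy).ge) x hx)
    (h₁.anti h₂ hf₁ hf₂ (fun _ hy => (h hy).le) x hx)

theorem admissible (h : IsPicardImage f g) (hf : Admissible f) : Admissible g := by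
  refine ⟨h.1, fun x y hx hxy => ⟨?_, ?_⟩⟩
  · have := monotoneOn_Ici_of_hasDerivWithinAt
      (fun x hx => (h.2 x hx).sub (hasDerivWithinAt_id x (Ici 0)))
      (fun x hx => sub_nonneg.2 (Real.one_le_exp (hf.inverse_nonneg hx.le)))
      hx (hx.trans hxy) hxy
    simp only [Pi.sub_apply, id] at this
    linarith
  · have := monotoneOn_Ici_of_hasDerivWithinAt
      (fun x hx => (Real.hasDerivAt_exp x).hasDerivWithinAt.sub (h.2 x hx))
      (fun x hx => sub_nonneg.2 (Real.exp_le_exp.2 (hf.inverse_le_self hx.le)))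
      hx (hx.trans hxy) hxy
    simp only [Pi.sub_apply] at this
    linarith

theorem convexOn (h : IsPicardImage f g) (hf : Admissible f) : ConvexOn ℝ (Ici 0) g := by
  have hd : ∀ x ∈ Ioi (0 : ℝ), deriv g x = Real.exp (inverseOnNonneg f x) := fun x hx =>
    ((h.2 x (Ioi_subset_Ici_self hx)).hasDerivAt (Ici_mem_nhds hx)).deriv
  refine MonotoneOn.convexOn_of_deriv (convex_Ici 0)
    (fun x hx => (h.2 x hx).continuousWithinAt) ?_ ?_
  · rw [interior_Ici]
    exact fun x hx =>
      ((h.2 x (Ioi_subset_Ici_self hx)).mono Ioi_subset_Ici_self).differentiableWithinAt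
  · rw [interior_Ici]
    intro x hx y hy hxy
    rw [hd x hx, hd y hy, Real.exp_le_exp]
    exact hf.inverse_monotoneOn (Ioi_subset_Ici_self hx) (Ioi_subset_Ici_self hy) hxy

/-- The Picard step is continuous for pointwise convergence. -/
theorem of_tendsto {ι : Type*} {l : Filter ι} [l.NeBot] [l.IsCountablyGenerated]
    {u v : ι → ℝ → ℝ} (hu : ∀ i, Admissible (u i)) (huv : ∀ i, IsPicardImage (u i) (v i))
    (hf : ∀ x ∈ Ici (0 : ℝ), Tendsto (fun i => u i x) l (𝓝 (f x)))
    (hg : ∀ x ∈ Ici (0 : ℝ), Tendsto (fun i => v i x) l (𝓝 (g x))) : IsPicardImage f g := by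
  have hfa : Admissible f := .of_tendsto hu hf
  -- `P f` is the image of `f`; it is shown to agree with `g`.
  let P : (ℝ → ℝ) → ℝ → ℝ :=
    fun w x => ∫ s in (0 : ℝ)..x, Real.exp (inverseOnNonneg w (max s 0))
  have hP : ∀ w, Admissible w → IsPicardImage w (P w) := fun w hw => isPicardImage_integral hw
  have hlim : ∀ x ∈ Ici (0 : ℝ), Tendsto (fun i => v i x) l (𝓝 (P f x)) := by
    intro x hx
    have hvP : ∀ i, v i x = P (u i) x := fun i =>
      (huv i).eqOn (hP _ (hu i)) (hu i) (hu i) (eqOn_refl _ _) hx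
    simp only [hvP]
    refine intervalIntegral.tendsto_integral_filter_of_dominated_convergence
      (fun _ => Real.exp x) (.of_forall fun i => ?_) (.of_forall fun i => ?_)
      intervalIntegrable_const ?_
    · have : Continuous fun s : ℝ => Real.exp (inverseOnNonneg (u i) (max s 0)) :=
        Real.continuous_exp.comp ((hu i).continuousOn_inverse.comp_continuous (by fun_prop)
          fun s => le_max_right s 0)
      exact this.aestronglyMeasurable
    · refine .of_forall fun s hs => ?_
      rw [uIoc_of_le hx] at hs
      rw [Real.norm_eq_abs, Real.abs_exp, Real.exp_le_exp]
      exact ((hu i).inverse_le_self (le_max_right s 0)).trans (max_le hs.2 hx)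
    · exact .of_forall fun s _ => (Real.continuous_exp.tendsto _).comp
        (Admissible.tendsto_inverse hu hfa hf (le_max_right s 0))
  have hgP : EqOn g (P f) (Ici 0) := fun x hx => tendsto_nhds_unique (hg x hx) (hlim x hx)
  exact ⟨(hgP self_mem_Ici).trans (hP f hfa).1, fun x hx =>
    ((hP f hfa).2 x hx).congr hgP (hgP hx)⟩

end IsPicardImage

theorem admissible_id : Admissible fun x => x := by
  refine ⟨rfl, fun x y hx hxy => ⟨le_rfl, ?_⟩⟩
  have := monotoneOn_Ici_of_hasDerivWithinAt
    (fun x _ => (Real.hasDerivAt_exp x).hasDerivWithinAt.sub (hasDerivWithinAt_id x (Ici 0)))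
    (fun x hx => sub_nonneg.2 (Real.one_le_exp hx.le)) hx (hx.trans hxy) hxy
  simp only [Pi.sub_apply, id] at this
  linarith

theorem Admissible.congr {f g : ℝ → ℝ} (hf : Admissible f) (h : EqOn g f (Ici 0)) :
    Admissible g := by
  refine ⟨(h self_mem_Ici).trans hf.1, fun x y hx hxy => ?_⟩
  rw [h hx, h (hx.trans hxy)]
  exact hf.2 x y hx hxy

/-! ### The iteration -/

namespace IsPicardIteration

variable {f g : ℕ → ℝ → ℝ}

theorem admissible (hf : IsPicardIteration f) : ∀ n, Admissible (f (n + 1))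
  | 0 => admissible_id.congr hf.1
  | n + 1 => (hf.2 (n + 1) (by omega)).admissible (hf.admissible n)

theorem eqOn (hf : IsPicardIteration f) (hg : IsPicardIteration g) :
    ∀ n, EqOn (f (n + 1)) (g (n + 1)) (Ici 0)
  | 0 => fun x hx => (hf.1 x hx).trans (hg.1 x hx).symm
  | n + 1 => (hf.2 (n + 1) (by omega)).eqOn (hg.2 (n + 1) (by omega)) (hf.admissible n)
      (hg.admissible n) (hf.eqOn hg n)

theorem convexOn (hf : IsPicardIteration f) : ∀ n, ConvexOn ℝ (Ici 0) (f (n + 1))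
  | 0 => (convexOn_id (convex_Ici 0)).congr fun x hx => (hf.1 x hx).symm
  | n + 1 => (hf.2 (n + 1) (by omega)).convexOn (hf.admissible n)

theorem lt_and_lt (hf : IsPicardIteration f) (k : ℕ) :
    (∀ x > 0, f (2 * k + 1) x < f (2 * k + 2) x) ∧
      ∀ x > 0, f (2 * k + 3) x < f (2 * k + 2) x := by
  have step : ∀ {n m : ℕ}, (∀ x > 0, f (n + 1) x < f (m + 1) x) →
      ∀ x > 0, f (m + 2) x < f (n + 2) x := fun {n m} h =>
    (hf.2 (n + 1) (by omega)).strictAnti (hf.2 (m + 1) (by omega)) (hf.admissible n)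
      (hf.admissible m) h
  have base : ∀ x > 0, f 1 x < f 2 x := by
    have h2 := hf.2 1 le_rfl
    intro x hx
    have := strictMonoOn_Ici_of_hasDerivWithinAt
      (fun x hx => (h2.2 x hx).sub (hasDerivWithinAt_id x (Ici 0)))
      (fun x hx => sub_pos.2 (Real.one_lt_exp_iff.2 (by
        have := (hf.admissible 0).inverse_nonneg hx.le
        have h1 := (hf.admissible 0).apply_inverse hx.le
        rw [zero_add, hf.1 _ this] at h1
        rwa [h1])))
      self_mem_Ici (mem_Ici.2 hx.le) hx
    simp only [Pi.sub_apply, id, h2.1] at this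
    rw [hf.1 x hx.le]
    linarith
  induction k with
  | zero => exact ⟨base, step base⟩
  | succ k ih => exact ⟨step ih.2, step (step ih.2)⟩

theorem le_and_ge (hf : IsPicardIteration f) (k : ℕ) :
    (∀ x ∈ Ici (0 : ℝ), f (2 * k + 1) x ≤ f (2 * k + 3) x) ∧
      ∀ x ∈ Ici (0 : ℝ), f (2 * k + 4) x ≤ f (2 * k + 2) x := by
  have step : ∀ {n m : ℕ}, (∀ x ∈ Ici (0 : ℝ), f (n + 1) x ≤ f (m + 1) x) →
      ∀ x ∈ Ici (0 : ℝ), f (m + 2) x ≤ f (n + 2) x := fun {n m} h =>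
    (hf.2 (n + 1) (by omega)).anti (hf.2 (m + 1) (by omega)) (hf.admissible n)
      (hf.admissible m) h
  have base : ∀ x ∈ Ici (0 : ℝ), f 1 x ≤ f 3 x := fun x hx =>
    (hf.1 x hx).le.trans ((hf.admissible 2).le_apply hx)
  induction k with
  | zero => exact ⟨base, step base⟩
  | succ k ih => exact ⟨step ih.2, step (step ih.2)⟩

theorem monotone_odd (hf : IsPicardIteration f) {x : ℝ} (hx : 0 ≤ x) :
    Monotone fun k : ℕ => f (2 * k + 1) x :=
  monotone_nat_of_le_succ fun k => (hf.le_and_ge k).1 x hx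

theorem antitone_even (hf : IsPicardIteration f) {x : ℝ} (hx : 0 ≤ x) :
    Antitone fun k : ℕ => f (2 * k + 2) x :=
  antitone_nat_of_succ_le fun k => (hf.le_and_ge k).2 x hx

end IsPicardIteration

theorem exists_isPicardIteration : ∃ f, IsPicardIteration f := by
  -- The step is chosen on all functions, with an arbitrary value at inadmissible ones.
  have h : ∀ f, ∃ g, Admissible f → IsPicardImage f g := fun f => by
    by_cases hf : Admissible f
    · exact ⟨_, fun _ => isPicardImage_integral hf⟩
    · exact ⟨f, fun h => absurd h hf⟩
  choose Φ hΦ using h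
  have hadm : ∀ n, Admissible (Φ^[n] fun x => x) := by
    intro n
    induction n with
    | zero => exact admissible_id
    | succ n ih =>
      rw [Function.iterate_succ_apply']
      exact (hΦ _ ih).admissible ih
  refine ⟨fun n => Φ^[n - 1] fun x => x, fun _ _ => rfl, fun n hn => ?_⟩
  obtain ⟨n, rfl⟩ : ∃ m, n = m + 1 := ⟨n - 1, by omega⟩
  simp only [Nat.add_sub_cancel, Function.iterate_succ_apply']
  exact hΦ _ (hadm n)

/-! ### Parametrized differentiability on the half-line -/

/-- A family `u t` of functions on `[0, ∞)`, indexed by a topological space, is `C^m` in the space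
variable with derivatives up to order `m` jointly continuous in the parameter and the space
variable. For the parameter space `ℕ∞` this is `C^m` regularity of a sequence together with
locally uniform convergence of its derivatives up to order `m`. -/
def ParamContDiff {T : Type*} [TopologicalSpace T] : ℕ → (T → ℝ → ℝ) → Prop
  | 0, u => ContinuousOn (Function.uncurry u) (univ ×ˢ Ici 0)
  | m + 1, u => ContinuousOn (Function.uncurry u) (univ ×ˢ Ici 0) ∧
      (∀ t, DifferentiableOn ℝ (u t) (Ici 0)) ∧
      ParamContDiff m fun t => derivWithin (u t) (Ici 0)

theorem HasDerivWithinAt.derivWithin_Ici {f : ℝ → ℝ} {f' x : ℝ}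
    (h : HasDerivWithinAt f f' (Ici 0) x) (hx : 0 ≤ x) : _root_.derivWithin f (Ici 0) x = f' :=
  h.derivWithin (uniqueDiffOn_Ici 0 x hx)

namespace ParamContDiff

variable {T : Type*} [TopologicalSpace T] {m : ℕ} {u v : T → ℝ → ℝ}

theorem continuousOn : ∀ {m : ℕ}, ParamContDiff m u →
    ContinuousOn (Function.uncurry u) (univ ×ˢ Ici 0)
  | 0, h => h
  | _ + 1, h => h.1

theorem congr (h : ParamContDiff m u) (huv : ∀ t, EqOn (v t) (u t) (Ici 0)) :
    ParamContDiff m v := by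
  have hc {u v : T → ℝ → ℝ} (h : ContinuousOn (Function.uncurry u) (univ ×ˢ Ici 0))
      (huv : ∀ t, EqOn (v t) (u t) (Ici 0)) :
      ContinuousOn (Function.uncurry v) (univ ×ˢ Ici 0) :=
    h.congr fun p hp => huv p.1 hp.2
  induction m generalizing u v with
  | zero => exact hc h huv
  | succ m ih =>
    exact ⟨hc h.1 huv, fun t => (h.2.1 t).congr (huv t),
      ih h.2.2 fun t x hx => derivWithin_congr (huv t) (huv t hx)⟩

theorem of_hasDerivWithinAt (hu : ContinuousOn (Function.uncurry u) (univ ×ˢ Ici 0))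
    (hd : ∀ t, ∀ x ∈ Ici (0 : ℝ), HasDerivWithinAt (u t) (v t x) (Ici 0) x)
    (hv : ParamContDiff m v) : ParamContDiff (m + 1) u :=
  ⟨hu, fun t x hx => (hd t x hx).differentiableWithinAt,
    hv.congr fun t x hx => (hd t x hx).derivWithin_Ici hx⟩

theorem hasDerivWithinAt (h : ParamContDiff (m + 1) u) (t : T) {x : ℝ} (hx : 0 ≤ x) :
    HasDerivWithinAt (u t) (derivWithin (u t) (Ici 0) x) (Ici 0) x :=
  (h.2.1 t x hx).hasDerivWithinAt

theorem of_succ (h : ParamContDiff (m + 1) u) : ParamContDiff m u := by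
  induction m generalizing u with
  | zero => exact h.1
  | succ m ih => exact ⟨h.1, h.2.1, ih h.2.2⟩

theorem const (c : ℝ) : ParamContDiff m fun (_ : T) (_ : ℝ) => c := by
  induction m generalizing c with
  | zero => exact continuousOn_const
  | succ m ih =>
    exact of_hasDerivWithinAt continuousOn_const (fun _ _ _ => hasDerivWithinAt_const _ _ _) (ih 0)

theorem exp : ParamContDiff m fun _ : T => Real.exp := by
  have hc : ContinuousOn (Function.uncurry fun _ : T => Real.exp) (univ ×ˢ Ici 0) :=
    (Real.continuous_exp.comp continuous_snd).continuousOn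
  induction m with
  | zero => exact hc
  | succ m ih =>
    exact of_hasDerivWithinAt hc (fun _ x _ => (Real.hasDerivAt_exp x).hasDerivWithinAt) ih

theorem add (hu : ParamContDiff m u) (hv : ParamContDiff m v) :
    ParamContDiff m fun t x => u t x + v t x := by
  induction m generalizing u v with
  | zero => exact ContinuousOn.add hu hv
  | succ m ih =>
    exact of_hasDerivWithinAt (hu.continuousOn.add hv.continuousOn)
      (fun t x hx => (hu.hasDerivWithinAt t hx).add (hv.hasDerivWithinAt t hx)) (ih hu.2.2 hv.2.2)

theorem mul (hu : ParamContDiff m u) (hv : ParamContDiff m v) :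
    ParamContDiff m fun t x => u t x * v t x := by
  induction m generalizing u v with
  | zero => exact ContinuousOn.mul hu hv
  | succ m ih =>
    exact of_hasDerivWithinAt (hu.continuousOn.mul hv.continuousOn)
      (fun t x hx => (hu.hasDerivWithinAt t hx).mul (hv.hasDerivWithinAt t hx))
      ((ih hu.2.2 hv.of_succ).add (ih hu.of_succ hv.2.2))

theorem inv (hu : ParamContDiff m u) (h0 : ∀ t, ∀ x ∈ Ici (0 : ℝ), u t x ≠ 0) :
    ParamContDiff m fun t x => (u t x)⁻¹ := by
  have hc : ContinuousOn (Function.uncurry fun t x => (u t x)⁻¹) (univ ×ˢ Ici 0) :=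
    hu.continuousOn.inv₀ fun p hp => h0 p.1 p.2 hp.2
  induction m with
  | zero => exact hc
  | succ m ih =>
    have hi := ih hu.of_succ
    refine of_hasDerivWithinAt hc
      (fun t x hx => (hu.hasDerivWithinAt t hx).inv (h0 t x hx))
      ((((const (-1)).mul hu.2.2).mul (hi.mul hi)).congr fun t x _ => ?_)
    simp only [div_eq_mul_inv, neg_mul, one_mul, pow_two, mul_inv]

theorem continuousOn_comp (hu : ContinuousOn (Function.uncurry u) (univ ×ˢ Ici 0))
    (hv : ContinuousOn (Function.uncurry v) (univ ×ˢ Ici 0))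
    (hmap : ∀ t, MapsTo (v t) (Ici 0) (Ici 0)) :
    ContinuousOn (Function.uncurry fun t x => u t (v t x)) (univ ×ˢ Ici 0) :=
  hu.comp (continuousOn_fst.prodMk hv) fun p hp => ⟨trivial, hmap p.1 hp.2⟩

theorem comp (hu : ParamContDiff m u) (hv : ParamContDiff m v)
    (hmap : ∀ t, MapsTo (v t) (Ici 0) (Ici 0)) :
    ParamContDiff m fun t x => u t (v t x) := by
  induction m generalizing u with
  | zero => exact continuousOn_comp hu hv hmap
  | succ m ih =>
    exact of_hasDerivWithinAt (continuousOn_comp hu.continuousOn hv.continuousOn hmap)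
      (fun t x hx => (hu.hasDerivWithinAt t (hmap t hx)).comp x
        (hv.hasDerivWithinAt t hx) (hmap t))
      ((ih hu.2.2 hv.of_succ).mul hv.2.2)

/-- A reparametrization does not affect joint differentiability. -/
theorem reparam {S : Type*} [TopologicalSpace S] {φ : S → T} (hφ : Continuous φ)
    (hu : ParamContDiff m u) : ParamContDiff m fun s => u (φ s) := by
  have hc {u : T → ℝ → ℝ} (h : ContinuousOn (Function.uncurry u) (univ ×ˢ Ici 0)) :
      ContinuousOn (Function.uncurry fun s => u (φ s)) (univ ×ˢ Ici 0) :=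
    h.comp (f := fun p : S × ℝ => (φ p.1, p.2)) (by fun_prop) fun p hp => ⟨trivial, hp.2⟩
  induction m generalizing u with
  | zero => exact hc hu
  | succ m ih => exact ⟨hc hu.1, fun s => hu.2.1 (φ s), ih hu.2.2⟩

/-- Families may be glued along a clopen partition of the parameter space. -/
theorem piecewise {s : Set T} [∀ t, Decidable (t ∈ s)] (hs : IsClopen s)
    (hu : ParamContDiff m u) (hv : ParamContDiff m v) : ParamContDiff m (s.piecewise u v) := by
  have hc {u v : T → ℝ → ℝ} (hu : ContinuousOn (Function.uncurry u) (univ ×ˢ Ici 0))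
      (hv : ContinuousOn (Function.uncurry v) (univ ×ˢ Ici 0)) :
      ContinuousOn (Function.uncurry (s.piecewise u v)) (univ ×ˢ Ici 0) := by
    have hfr : frontier {p : T × ℝ | p.1 ∈ s} = ∅ := (hs.preimage continuous_fst).frontier_eq
    refine (ContinuousOn.if (p := fun p : T × ℝ => p.1 ∈ s) (by simp [hfr])
      (hu.mono inter_subset_left) (hv.mono inter_subset_left)).congr fun p _ => ?_
    simp only [Function.uncurry, Set.piecewise]
    split_ifs <;> rfl
  induction m generalizing u v with
  | zero => exact hc hu hv
  | succ m ih =>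
    refine ⟨hc hu.1 hv.1, fun t => ?_, (ih hu.2.2 hv.2.2).congr fun t x _ => ?_⟩
    · by_cases ht : t ∈ s
      · simpa [ht] using hu.2.1 t
      · simpa [ht] using hv.2.1 t
    · by_cases ht : t ∈ s <;> simp [ht]

theorem contDiffOn (hu : ParamContDiff m u) (t : T) : ContDiffOn ℝ m (u t) (Ici 0) := by
  induction m generalizing u with
  | zero =>
    refine contDiffOn_zero.2 (hu.continuousOn.comp (f := fun x => (t, x)) (by fun_prop) ?_)
    exact fun x hx => ⟨trivial, hx⟩
  | succ m ih =>
    rw [Nat.cast_succ, contDiffOn_succ_iff_derivWithin (uniqueDiffOn_Ici 0)]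
    exact ⟨hu.2.1 t, fun h => absurd h (by simp), ih hu.2.2⟩

theorem continuousOn_iteratedDerivWithin (hu : ParamContDiff m u) :
    ContinuousOn (Function.uncurry fun t => iteratedDerivWithin m (u t) (Ici 0))
      (univ ×ˢ Ici 0) := by
  induction m generalizing u with
  | zero => simpa [iteratedDerivWithin_zero] using hu.continuousOn
  | succ m ih => simpa only [iteratedDerivWithin_succ'] using ih hu.2.2

/-- Pointwise continuity in the parameter is joint continuity for a family that is equicontinuous
in the space variable. -/
theorem zero_of_abs_sub_le {φ : ℝ → ℝ} (hφ : Continuous φ)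
    (hu : ∀ t, ∀ x ∈ Ici (0 : ℝ), ∀ y ∈ Ici (0 : ℝ), |u t y - u t x| ≤ |φ y - φ x|)
    (hc : ∀ x ∈ Ici (0 : ℝ), Continuous fun t => u t x) : ParamContDiff 0 u := by
  rintro ⟨t, x⟩ ⟨-, hx⟩
  rw [ContinuousWithinAt, tendsto_iff_dist_tendsto_zero]
  have h : Tendsto (fun p : T × ℝ => |φ p.2 - φ x| + |u p.1 x - u t x|)
      (𝓝[univ ×ˢ Ici 0] (t, x)) (𝓝 0) := by
    have hc' := hc x hx
    have : Continuous fun p : T × ℝ => |φ p.2 - φ x| + |u p.1 x - u t x| := by fun_prop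
    simpa using (this.tendsto (t, x)).mono_left nhdsWithin_le_nhds
  refine squeeze_zero' (.of_forall fun _ => dist_nonneg) ?_ h
  filter_upwards [self_mem_nhdsWithin] with p hp
  calc |u p.1 p.2 - u t x| ≤ |u p.1 p.2 - u p.1 x| + |u p.1 x - u t x| := abs_sub_le _ _ _
    _ ≤ _ := by exact add_le_add_left (hu p.1 x hx p.2 hp.2) _

theorem zero_of_admissible (hu : ∀ t, Admissible (u t))
    (hc : ∀ x ∈ Ici (0 : ℝ), Continuous fun t => u t x) : ParamContDiff 0 u :=
  zero_of_abs_sub_le Real.continuous_exp (fun t _ hx _ hy => (hu t).abs_sub_le hx hy) hc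

end ParamContDiff

theorem Admissible.one_le_of_hasDerivWithinAt {f : ℝ → ℝ} (hf : Admissible f) {x d : ℝ}
    (hx : 0 ≤ x) (hd : HasDerivWithinAt f d (Ici 0) x) : 1 ≤ d := by
  have hmono : MonotoneOn (f - id) (Ici 0) := fun a ha b _ hab => by
    have := (hf.2 a b ha hab).1
    simp only [Pi.sub_apply, id]
    linarith
  have := hmono.derivWithin_nonneg (x := x)
  rw [(hd.sub (hasDerivWithinAt_id x _)).derivWithin_Ici hx] at this
  linarith

theorem Admissible.hasDerivWithinAt_inverse {f : ℝ → ℝ} (hf : Admissible f) {y d : ℝ}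
    (hy : 0 ≤ y) (hd : HasDerivWithinAt f d (Ici 0) (inverseOnNonneg f y)) :
    HasDerivWithinAt (inverseOnNonneg f) d⁻¹ (Ici 0) y := by
  have hd0 : d ≠ 0 :=
    (zero_lt_one.trans_le (hf.one_le_of_hasDerivWithinAt (hf.inverse_nonneg hy) hd)).ne'
  have hd' : HasFDerivWithinAt f
      (ContinuousLinearEquiv.unitsEquivAut ℝ (Units.mk0 d hd0) : ℝ →L[ℝ] ℝ) (Ici 0)
      (inverseOnNonneg f y) := by
    have : (ContinuousLinearEquiv.unitsEquivAut ℝ (Units.mk0 d hd0) : ℝ →L[ℝ] ℝ) =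
        ContinuousLinearMap.toSpanSingleton ℝ d := by
      ext
      simp
    rw [this]
    exact hd.hasFDerivWithinAt
  have hmem : ∀ z ∈ Ici (0 : ℝ), inverseOnNonneg f z ∈ Ici (0 : ℝ) :=
    fun z hz => hf.inverse_nonneg hz
  have := hd'.of_local_left_inverse
    (tendsto_nhdsWithin_of_tendsto_nhds_of_eventually_within _ (hf.continuousOn_inverse y hy)
      (eventually_mem_nhdsWithin.mono hmem)) hy
    (eventually_mem_nhdsWithin.mono fun z hz => hf.apply_inverse hz)
  simpa using this.hasDerivWithinAt

/-- Inversion of admissible functions preserves joint differentiability, by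
`(f⁻¹)' = (f' ∘ f⁻¹)⁻¹`. -/
theorem ParamContDiff.inverse {T : Type*} [TopologicalSpace T] {m : ℕ} {u : T → ℝ → ℝ}
    (hu : ParamContDiff m u) (ha : ∀ t, Admissible (u t)) :
    ParamContDiff m fun t => inverseOnNonneg (u t) := by
  have hc : ParamContDiff 0 fun t => inverseOnNonneg (u t) := by
    refine .zero_of_abs_sub_le continuous_id
      (fun t x hx y hy => (ha t).abs_inverse_sub_le hx hy) fun y hy => ?_
    refine continuous_iff_continuousAt.2 fun t => Admissible.tendsto_inverse ha (ha t) ?_ hy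
    intro x hx
    have : Continuous fun s => u s x :=
      hu.continuousOn.comp_continuous (f := fun s => (s, x)) (by fun_prop) fun s => ⟨trivial, hx⟩
    exact this.tendsto t
  induction m with
  | zero => exact hc
  | succ m ih =>
    refine of_hasDerivWithinAt hc (fun t y hy => (ha t).hasDerivWithinAt_inverse hy
      (hu.hasDerivWithinAt t ((ha t).inverse_nonneg hy)))
      ((hu.2.2.comp (ih hu.of_succ) fun t y hy => (ha t).inverse_nonneg hy).inv fun t y hy => ?_)
    have := (ha t).one_le_of_hasDerivWithinAt ((ha t).inverse_nonneg hy)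
      (hu.hasDerivWithinAt t ((ha t).inverse_nonneg hy))
    positivity

/-! ### Sequences as families over `ℕ∞` -/

/-- The family over `ℕ∞` consisting of the sequence `u` and its limit `g` at `⊤`. -/
def withLimit (u : ℕ → ℝ → ℝ) (g : ℝ → ℝ) (t : ℕ∞) : ℝ → ℝ :=
  if t = ⊤ then g else u t.toNat

section withLimit

variable {u : ℕ → ℝ → ℝ} {g : ℝ → ℝ}

@[simp]
theorem withLimit_top : withLimit u g ⊤ = g := if_pos rfl

@[simp]
theorem withLimit_natCast (n : ℕ) : withLimit u g n = u n := by
  simp [withLimit]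

theorem continuous_withLimit {x : ℝ} (h : Tendsto (fun k => u k x) atTop (𝓝 (g x))) :
    Continuous fun t => withLimit u g t x := by
  refine continuous_iff_continuousAt.2 fun t => ?_
  induction t using ENat.recTopCoe with
  | coe n => 
    rw [ContinuousAt, ENat.nhds_natCast]
    exact tendsto_pure_nhds _ _
  | top =>
    rw [ContinuousAt, withLimit_top, Filter.tendsto_def]
    intro s hs
    obtain ⟨N, hN⟩ := eventually_atTop.1 (h hs)
    filter_upwards [Ioi_mem_nhds (ENat.natCast_lt_top N)] with t ht
    induction t using ENat.recTopCoe with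
    | top => simpa using mem_of_mem_nhds hs
    | coe n => simpa using hN n (by simpa using (mem_Ioi.1 ht).le)

theorem tendstoLocallyUniformlyOn_of_withLimit {w : ℕ∞ → ℝ → ℝ}
    (h : ContinuousOn (Function.uncurry w) (univ ×ˢ Ici 0)) :
    TendstoLocallyUniformlyOn (fun k : ℕ => w k) (w ⊤) atTop (Ici 0) := by
  rw [tendstoLocallyUniformlyOn_iff_forall_tendsto]
  intro x hx
  refine Filter.Tendsto.mono_right ?_ (nhds_le_uniformity (w ⊤ x))
  have hlim := h (⊤, x) ⟨trivial, hx⟩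
  rw [ContinuousWithinAt, nhdsWithin_prod_eq, nhdsWithin_univ] at hlim
  have h1 : Tendsto (fun p : ℕ × ℝ => ((p.1 : ℕ∞), p.2)) (atTop ×ˢ 𝓝[Ici 0] x)
      (𝓝 ⊤ ×ˢ 𝓝[Ici 0] x) := ENat.tendsto_natCast_nhds_top.prodMap tendsto_id
  have h2 : Tendsto (fun p : ℕ × ℝ => ((⊤ : ℕ∞), p.2)) (atTop ×ˢ 𝓝[Ici 0] x)
      (𝓝 ⊤ ×ˢ 𝓝[Ici 0] x) := (tendsto_const_nhds (x := (⊤ : ℕ∞))).prodMap tendsto_id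
  exact (hlim.comp h2).prodMk_nhds (hlim.comp h1)

theorem tendstoLocallySmooth_of_withLimit (h : ∀ m, ParamContDiff m (withLimit u g)) :
    TendstoLocallySmooth u g := by
  refine ⟨fun k => contDiffOn_infty.2 fun m => by simpa using (h m).contDiffOn k,
    contDiffOn_infty.2 fun m => by simpa using (h m).contDiffOn ⊤, fun m => ?_⟩
  simpa using tendstoLocallyUniformlyOn_of_withLimit (h m).continuousOn_iteratedDerivWithin

end withLimit

/-! ### Congruences of formal power series -/

namespace PowerSeries

variable {F G U V W : PowerSeries ℝ} {n : ℕ}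

theorem constantCoeff_subst_of_zero (hV : constantCoeff V = 0) (U : PowerSeries ℝ) :
    constantCoeff (subst V U) = constantCoeff U := by
  have hs : HasSubst V := .of_constantCoeff_zero' hV
  rw [← coeff_zero_eq_constantCoeff_apply, coeff_subst' hs, finsum_eq_single _ 0]
  · simp
  · intro d hd
    simp [hV, hd]

theorem eq_of_forall_X_pow_dvd_sub (h : ∀ n, X ^ n ∣ F - G) : F = G := by
  ext n
  have := X_pow_dvd_iff.1 (h (n + 1)) n (Nat.lt_succ_self n)
  rwa [map_sub, sub_eq_zero] at this

/-- In characteristic zero, congruences modulo powers of `X` can be integrated. -/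
theorem X_pow_succ_dvd_sub (h0 : constantCoeff F = constantCoeff G)
    (h : X ^ n ∣ derivative ℝ F - derivative ℝ G) : X ^ (n + 1) ∣ F - G := by
  rw [X_pow_dvd_iff]
  rintro (_ | k) hk
  · simp [h0]
  · have := X_pow_dvd_iff.1 h k (by omega)
    rw [map_sub, coeff_derivative, coeff_derivative, ← sub_mul] at this
    rw [map_sub]
    exact (mul_eq_zero.1 this).resolve_right (by positivity)

theorem X_pow_dvd_derivative_sub (h : X ^ (n + 1) ∣ F - G) :
    X ^ n ∣ derivative ℝ F - derivative ℝ G := by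
  rw [X_pow_dvd_iff] at h ⊢
  intro k hk
  have := h (k + 1) (by omega)
  rw [map_sub] at this
  rw [map_sub, coeff_derivative, coeff_derivative, ← sub_mul, this, zero_mul]

theorem X_pow_dvd_mul_sub (h₁ : X ^ n ∣ F - G) (h₂ : X ^ n ∣ U - V) :
    X ^ n ∣ F * U - G * V := by
  have : F * U - G * V = (F - G) * U + G * (U - V) := by ring
  rw [this]
  exact dvd_add (h₁.mul_right _) (h₂.mul_left _)

theorem X_pow_dvd_subst_sub_subst_left (hV : constantCoeff V = 0) (hW : constantCoeff W = 0)
    (h : X ^ n ∣ V - W) (U : PowerSeries ℝ) : X ^ n ∣ subst V U - subst W U := by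
  induction n generalizing U with
  | zero => simp
  | succ n ih =>
    refine X_pow_succ_dvd_sub ?_ ?_
    · rw [constantCoeff_subst_of_zero hV, constantCoeff_subst_of_zero hW]
    · rw [derivative_subst (.of_constantCoeff_zero' hV),
        derivative_subst (.of_constantCoeff_zero' hW)]
      exact X_pow_dvd_mul_sub (ih ((pow_dvd_pow _ n.le_succ).trans h) _)
        (X_pow_dvd_derivative_sub h)

theorem X_pow_dvd_subst_sub_subst_right (hV : constantCoeff V = 0) (h : X ^ n ∣ F - G) :
    X ^ n ∣ subst V F - subst V G := by
  have hs : HasSubst V := .of_constantCoeff_zero' hV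
  obtain ⟨H, hH⟩ := h
  rw [← subst_sub hs, hH, subst_mul hs, subst_pow hs, subst_X hs]
  exact (pow_dvd_pow_of_dvd (X_dvd_iff.2 hV) n).mul_right _

end PowerSeries

/-! ### Formal orbits of order two -/

open PowerSeries in
theorem IsCompInverse.X_pow_dvd_sub {F₁ F₂ G₁ G₂ : PowerSeries ℝ} {n : ℕ}
    (h₁ : IsCompInverse F₁ G₁) (h₂ : IsCompInverse F₂ G₂) (h : X ^ n ∣ F₁ - F₂) :
    X ^ n ∣ G₁ - G₂ := by
  obtain ⟨hF₁, hG₁, -, hGF₁⟩ := h₁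
  obtain ⟨hF₂, hG₂, hFG₂, -⟩ := h₂
  have e₁ : subst G₂ (subst F₂ G₁) = G₁ := by
    rw [subst_comp_subst_apply (.of_constantCoeff_zero' hF₂) (.of_constantCoeff_zero' hG₂), hFG₂,
      X_subst]
  have e₂ : subst G₂ (subst F₁ G₁) = G₂ := by
    rw [hGF₁, subst_X (.of_constantCoeff_zero' hG₂)]
  have := X_pow_dvd_subst_sub_subst_right hG₂
    (X_pow_dvd_subst_sub_subst_left hF₂ hF₁ ((dvd_sub_comm).1 h) G₁)
  rwa [e₁, e₂] at this

/-- `G` is the formal Picard image of `F`: `G' = exp (F⁻¹)`, `G(0) = 0`. -/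
def IsFormalPicardImage (F G : PowerSeries ℝ) : Prop :=
  PowerSeries.constantCoeff G = 0 ∧
    ∃ H : PowerSeries ℝ, IsCompInverse F H ∧
      PowerSeries.derivative ℝ G = PowerSeries.subst H (PowerSeries.exp ℝ)

theorem isFormalSolution_iff {F : PowerSeries ℝ} :
    IsFormalSolution F ↔ IsFormalPicardImage F F :=
  ⟨fun ⟨H, hH, hd⟩ => ⟨hH.1, H, hH, hd⟩, fun ⟨_, H, hH, hd⟩ => ⟨H, hH, hd⟩⟩

open PowerSeries in
/-- The formal Picard step improves the order of agreement of two power series by one. -/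
theorem IsFormalPicardImage.X_pow_succ_dvd_sub {F₁ F₂ G₁ G₂ : PowerSeries ℝ} {n : ℕ}
    (h₁ : IsFormalPicardImage F₁ G₁) (h₂ : IsFormalPicardImage F₂ G₂) (h : X ^ n ∣ F₁ - F₂) :
    X ^ (n + 1) ∣ G₁ - G₂ := by
  obtain ⟨h0₁, H₁, hH₁, hd₁⟩ := h₁
  obtain ⟨h0₂, H₂, hH₂, hd₂⟩ := h₂
  refine PowerSeries.X_pow_succ_dvd_sub (h0₁.trans h0₂.symm) ?_
  rw [hd₁, hd₂]
  exact X_pow_dvd_subst_sub_subst_left hH₁.2.1 hH₂.2.1 (hH₁.X_pow_dvd_sub hH₂ h) _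

/-- There is at most one formal orbit of order two. -/
theorem IsFormalPicardImage.orbit_unique {P Q P' Q' : PowerSeries ℝ}
    (hPQ : IsFormalPicardImage P Q) (hQP : IsFormalPicardImage Q P)
    (hPQ' : IsFormalPicardImage P' Q') (hQP' : IsFormalPicardImage Q' P') :
    P = P' ∧ Q = Q' := by
  have h : ∀ n, PowerSeries.X ^ n ∣ P - P' ∧ PowerSeries.X ^ n ∣ Q - Q' := by
    intro n
    induction n with
    | zero => simp
    | succ n ih => exact ⟨hQP.X_pow_succ_dvd_sub hQP' ih.2, hPQ.X_pow_succ_dvd_sub hPQ' ih.1⟩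
  exact ⟨PowerSeries.eq_of_forall_X_pow_dvd_sub fun n => (h n).1,
    PowerSeries.eq_of_forall_X_pow_dvd_sub fun n => (h n).2⟩

/-! ### Taylor series at the endpoint of the half-line -/

/-- The Taylor series at `0` of a function that is smooth on `[0, ∞)`. -/
noncomputable def taylorSeries (u : ℝ → ℝ) : PowerSeries ℝ :=
  PowerSeries.mk fun m => iteratedDerivWithin m u (Ici 0) 0 / (m.factorial : ℝ)

section taylorSeries

variable {u v : ℝ → ℝ}

theorem constantCoeff_taylorSeries : PowerSeries.constantCoeff (taylorSeries u) = u 0 := by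
  rw [← PowerSeries.coeff_zero_eq_constantCoeff_apply]
  simp [taylorSeries]

theorem derivative_taylorSeries :
    PowerSeries.derivative ℝ (taylorSeries u) = taylorSeries (derivWithin u (Ici 0)) := by
  ext n
  rw [PowerSeries.coeff_derivative]
  simp only [taylorSeries, PowerSeries.coeff_mk, iteratedDerivWithin_succ', Nat.factorial_succ]
  push_cast
  field_simp

theorem taylorSeries_congr (h : EqOn u v (Ici 0)) : taylorSeries u = taylorSeries v := by
  ext n
  simp only [taylorSeries, PowerSeries.coeff_mk]
  rw [iteratedDerivWithin_congr h self_mem_Ici]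

theorem ContDiffOn.hasDerivWithinAt_Ici (hu : ContDiffOn ℝ ∞ u (Ici 0)) {x : ℝ} (hx : 0 ≤ x) :
    HasDerivWithinAt u (derivWithin u (Ici 0) x) (Ici 0) x :=
  ((contDiffOn_infty_iff_derivWithin (uniqueDiffOn_Ici 0)).1 hu).1 x hx |>.hasDerivWithinAt

theorem ContDiffOn.derivWithin_Ici (hu : ContDiffOn ℝ ∞ u (Ici 0)) :
    ContDiffOn ℝ ∞ (derivWithin u (Ici 0)) (Ici 0) :=
  ((contDiffOn_infty_iff_derivWithin (uniqueDiffOn_Ici 0)).1 hu).2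

theorem taylorSeries_add (hu : ContDiffOn ℝ ∞ u (Ici 0)) (hv : ContDiffOn ℝ ∞ v (Ici 0)) :
    taylorSeries (u + v) = taylorSeries u + taylorSeries v := by
  ext n
  simp only [taylorSeries, PowerSeries.coeff_mk, map_add]
  rw [iteratedDerivWithin_add self_mem_Ici (uniqueDiffOn_Ici 0)
    ((contDiffOn_infty.1 hu n) 0 self_mem_Ici) ((contDiffOn_infty.1 hv n) 0 self_mem_Ici), add_div]

theorem taylorSeries_mul (hu : ContDiffOn ℝ ∞ u (Ici 0)) (hv : ContDiffOn ℝ ∞ v (Ici 0)) :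
    taylorSeries (u * v) = taylorSeries u * taylorSeries v := by
  refine PowerSeries.eq_of_forall_X_pow_dvd_sub fun n => ?_
  induction n generalizing u v with
  | zero => simp
  | succ n ih =>
    refine PowerSeries.X_pow_succ_dvd_sub (by simp [constantCoeff_taylorSeries]) ?_
    have hd : EqOn (derivWithin (u * v) (Ici 0))
        (derivWithin u (Ici 0) * v + u * derivWithin v (Ici 0)) (Ici 0) := fun x hx =>
      ((hu.hasDerivWithinAt_Ici hx).mul (hv.hasDerivWithinAt_Ici hx)).derivWithin_Ici hx
    rw [derivative_taylorSeries, taylorSeries_congr hd,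
      taylorSeries_add (u := derivWithin u (Ici 0) * v) (v := u * derivWithin v (Ici 0))
        (hu.derivWithin_Ici.mul hv) (hu.mul hv.derivWithin_Ici),
      Derivation.leibniz, derivative_taylorSeries, derivative_taylorSeries, smul_eq_mul,
      smul_eq_mul, add_comm (taylorSeries u * _), mul_comm (taylorSeries v), add_sub_add_comm]
    exact dvd_add (ih hu.derivWithin_Ici hv) (ih hu hv.derivWithin_Ici)

theorem taylorSeries_comp (hu : ContDiffOn ℝ ∞ u (Ici 0)) (hv : ContDiffOn ℝ ∞ v (Ici 0))
    (hmap : MapsTo v (Ici 0) (Ici 0)) (h0 : v 0 = 0) :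
    taylorSeries (u ∘ v) = PowerSeries.subst (taylorSeries v) (taylorSeries u) := by
  have hc : PowerSeries.constantCoeff (taylorSeries v) = 0 := by
    rw [constantCoeff_taylorSeries, h0]
  refine PowerSeries.eq_of_forall_X_pow_dvd_sub fun n => ?_
  induction n generalizing u with
  | zero => simp
  | succ n ih =>
    refine PowerSeries.X_pow_succ_dvd_sub ?_ ?_
    · rw [PowerSeries.constantCoeff_subst_of_zero hc]
      simp [constantCoeff_taylorSeries, h0]
    · have hd : EqOn (derivWithin (u ∘ v) (Ici 0))
          ((derivWithin u (Ici 0) ∘ v) * derivWithin v (Ici 0)) (Ici 0) := fun x hx =>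
        ((hu.hasDerivWithinAt_Ici (hmap hx)).comp x (hv.hasDerivWithinAt_Ici hx)
          hmap).derivWithin_Ici hx
      rw [derivative_taylorSeries, taylorSeries_congr hd,
        taylorSeries_mul (hu.derivWithin_Ici.comp hv hmap) hv.derivWithin_Ici,
        PowerSeries.derivative_subst (.of_constantCoeff_zero' hc), derivative_taylorSeries,
        derivative_taylorSeries]
      exact PowerSeries.X_pow_dvd_mul_sub (ih hu.derivWithin_Ici) (by simp)

theorem taylorSeries_exp : taylorSeries Real.exp = PowerSeries.exp ℝ := by
  refine PowerSeries.exp_unique_of_derivative_eq_self ?_ ?_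
  · rw [derivative_taylorSeries]
    exact taylorSeries_congr fun x hx =>
      (Real.hasDerivAt_exp x).hasDerivWithinAt.derivWithin_Ici hx
  · rw [constantCoeff_taylorSeries, Real.exp_zero]

theorem taylorSeries_id : taylorSeries id = PowerSeries.X := by
  refine PowerSeries.derivative.ext ?_ (by simp [constantCoeff_taylorSeries])
  rw [derivative_taylorSeries, PowerSeries.derivative_X,
    taylorSeries_congr fun x hx => (hasDerivWithinAt_id x (Ici 0)).derivWithin_Ici hx]
  ext n
  by_cases hn : n = 0 <;>
    simp [taylorSeries, iteratedDerivWithin_const, PowerSeries.coeff_one, hn]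

/-- A single smooth function is a family over the one-point space. -/
theorem ParamContDiff.of_contDiffOn {m : ℕ} (hu : ContDiffOn ℝ ∞ u (Ici 0)) :
    ParamContDiff m fun _ : Unit => u := by
  have hc {u : ℝ → ℝ} (h : ContDiffOn ℝ ∞ u (Ici 0)) :
      ContinuousOn (Function.uncurry fun _ : Unit => u) (univ ×ˢ Ici 0) :=
    h.continuousOn.comp continuousOn_snd fun p hp => hp.2
  induction m generalizing u with
  | zero => exact hc hu
  | succ m ih =>
    exact .of_hasDerivWithinAt (hc hu) (fun _ x hx => hu.hasDerivWithinAt_Ici hx)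
      (ih hu.derivWithin_Ici)

theorem Admissible.contDiffOn_inverse {f : ℝ → ℝ} (hf : Admissible f)
    (hs : ContDiffOn ℝ ∞ f (Ici 0)) : ContDiffOn ℝ ∞ (inverseOnNonneg f) (Ici 0) :=
  contDiffOn_infty.2 fun _ =>
    ((ParamContDiff.of_contDiffOn hs).inverse fun _ => hf).contDiffOn ()

theorem Admissible.isCompInverse_taylorSeries {f : ℝ → ℝ} (hf : Admissible f)
    (hs : ContDiffOn ℝ ∞ f (Ici 0)) :
    IsCompInverse (taylorSeries f) (taylorSeries (inverseOnNonneg f)) := by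
  have hi := hf.contDiffOn_inverse hs
  refine ⟨by rw [constantCoeff_taylorSeries, hf.1],
    by rw [constantCoeff_taylorSeries, hf.inverse_zero], ?_, ?_⟩
  · rw [← taylorSeries_comp hs hi (fun y hy => hf.inverse_nonneg hy) hf.inverse_zero,
      ← taylorSeries_id]
    exact taylorSeries_congr fun y hy => hf.apply_inverse hy
  · rw [← taylorSeries_comp hi hs hf.bijOn.mapsTo hf.1, ← taylorSeries_id]
    exact taylorSeries_congr fun y hy => hf.inverse_apply hy

/-- Taylor series at `0` turn Picard images into formal Picard images. -/
theorem IsPicardImage.taylorSeries {f g : ℝ → ℝ} (h : IsPicardImage f g) (hf : Admissible f)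
    (hs : ContDiffOn ℝ ∞ f (Ici 0)) :
    IsFormalPicardImage (taylorSeries f) (taylorSeries g) := by
  have hi := hf.contDiffOn_inverse hs
  refine ⟨by rw [constantCoeff_taylorSeries, h.1], _, hf.isCompInverse_taylorSeries hs, ?_⟩
  rw [derivative_taylorSeries, ← taylorSeries_exp, ← taylorSeries_comp
    Real.contDiff_exp.contDiffOn hi (fun y hy => hf.inverse_nonneg hy) hf.inverse_zero]
  exact taylorSeries_congr fun x hx => (h.2 x hx).derivWithin_Ici hx

end taylorSeries

/-! ### The limits of the odd and even subsequences -/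

namespace IsPicardIteration

variable {f : ℕ → ℝ → ℝ}

theorem exists_tendsto_odd (hf : IsPicardIteration f) :
    ∃ fm : ℝ → ℝ, ∀ x ∈ Ici (0 : ℝ), Tendsto (fun k : ℕ => f (2 * k + 1) x) atTop (𝓝 (fm x)) := by
  refine ⟨fun x => ⨆ k : ℕ, f (2 * k + 1) x, fun x hx =>
    tendsto_atTop_ciSup (hf.monotone_odd hx) ⟨Real.exp x - 1, ?_⟩⟩
  rintro _ ⟨k, rfl⟩
  exact (hf.admissible (2 * k)).apply_le hx

theorem exists_tendsto_even (hf : IsPicardIteration f) :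
    ∃ fp : ℝ → ℝ, ∀ x ∈ Ici (0 : ℝ), Tendsto (fun k : ℕ => f (2 * k + 2) x) atTop (𝓝 (fp x)) := by
  refine ⟨fun x => ⨅ k : ℕ, f (2 * k + 2) x, fun x hx =>
    tendsto_atTop_ciInf (hf.antitone_even hx) ⟨0, ?_⟩⟩
  rintro _ ⟨k, rfl⟩
  exact (hf.admissible (2 * k + 1)).apply_nonneg hx

variable {fm fp : ℝ → ℝ}

theorem isPicardImage_limit_even (hf : IsPicardIteration f)
    (hm : ∀ x ∈ Ici (0 : ℝ), Tendsto (fun k : ℕ => f (2 * k + 1) x) atTop (𝓝 (fm x)))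
    (hp : ∀ x ∈ Ici (0 : ℝ), Tendsto (fun k : ℕ => f (2 * k + 2) x) atTop (𝓝 (fp x))) :
    IsPicardImage fm fp :=
  .of_tendsto (fun k => hf.admissible (2 * k)) (fun k => hf.2 (2 * k + 1) (by omega)) hm hp

theorem isPicardImage_limit_odd (hf : IsPicardIteration f)
    (hm : ∀ x ∈ Ici (0 : ℝ), Tendsto (fun k : ℕ => f (2 * k + 1) x) atTop (𝓝 (fm x)))
    (hp : ∀ x ∈ Ici (0 : ℝ), Tendsto (fun k : ℕ => f (2 * k + 2) x) atTop (𝓝 (fp x))) :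
    IsPicardImage fp fm :=
  .of_tendsto (fun k => hf.admissible (2 * k + 1)) (fun k => hf.2 (2 * k + 2) (by omega)) hp
    fun x hx => (hm x hx).comp (tendsto_add_atTop_nat 1)

/-- The bootstrap: the odd and the even subsequence, together with their limits, are jointly
`C^m` for every `m`, because each Picard step gains one derivative. -/
theorem paramContDiff (hf : IsPicardIteration f)
    (hm : ∀ x ∈ Ici (0 : ℝ), Tendsto (fun k : ℕ => f (2 * k + 1) x) atTop (𝓝 (fm x)))
    (hp : ∀ x ∈ Ici (0 : ℝ), Tendsto (fun k : ℕ => f (2 * k + 2) x) atTop (𝓝 (fp x))) (m : ℕ) :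
    ParamContDiff m (withLimit (fun k => f (2 * k + 1)) fm) ∧
      ParamContDiff m (withLimit (fun k => f (2 * k + 2)) fp) := by
  set A := withLimit (fun k => f (2 * k + 1)) fm with hA
  set B := withLimit (fun k => f (2 * k + 2)) fp with hB
  have hAa : ∀ t, Admissible (A t) := fun t => by
    induction t using ENat.recTopCoe with
    | top => simpa [hA] using Admissible.of_tendsto (fun k => hf.admissible (2 * k)) hm
    | coe k => simpa [hA] using hf.admissible (2 * k)
  have hBa : ∀ t, Admissible (B t) := fun t => by
    induction t using ENat.recTopCoe with
    | top => simpa [hB] using Admissible.of_tendsto (fun k => hf.admissible (2 * k + 1)) hp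
    | coe k => simpa [hB] using hf.admissible (2 * k + 1)
  have hAB : ∀ t, IsPicardImage (A t) (B t) := fun t => by
    induction t using ENat.recTopCoe with
    | top => simpa [hA, hB] using hf.isPicardImage_limit_even hm hp
    | coe k => simpa [hA, hB] using hf.2 (2 * k + 1) (by omega)
  have hBA : ∀ t ≠ 0, IsPicardImage (B (t - 1)) (A t) := fun t ht => by
    induction t using ENat.recTopCoe with
    | top => simpa [hA, hB] using hf.isPicardImage_limit_odd hm hp
    | coe k =>
      obtain ⟨k, rfl⟩ := Nat.exists_eq_succ_of_ne_zero (n := k) (by simpa using ht)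
      have hk : ((k.succ : ℕ) : ℕ∞) - 1 = (k : ℕ) := by norm_cast
      rw [hk, hA, hB, withLimit_natCast, withLimit_natCast]
      exact hf.2 (2 * k + 2) (by omega)
  have hA0 : ParamContDiff 0 A := .zero_of_admissible hAa fun x hx => continuous_withLimit (hm x hx)
  have hB0 : ParamContDiff 0 B := .zero_of_admissible hBa fun x hx => continuous_withLimit (hp x hx)
  induction m with
  | zero => exact ⟨hA0, hB0⟩
  | succ m ih =>
    have hexp : ∀ {w : ℕ∞ → ℝ → ℝ}, (∀ t, Admissible (w t)) → ParamContDiff m w →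
        ParamContDiff m fun t x => Real.exp (inverseOnNonneg (w t) x) := fun ha hw =>
      ParamContDiff.exp.comp (hw.inverse ha) fun t y hy => (ha t).inverse_nonneg hy
    refine ⟨?_, .of_hasDerivWithinAt hB0.continuousOn (fun t => (hAB t).2) (hexp hAa ih.1)⟩
    -- The first iterate is not a Picard image: its derivative `1` is glued in at the index `0`.
    have hpred : Continuous fun t : ℕ∞ => t - 1 :=
      continuous_id.enatSub continuous_const fun _ => .inr (by simp)
    have hclopen : IsClopen ({0} : Set ℕ∞) :=
      ⟨isClosed_singleton, ENat.isOpen_singleton (by simp)⟩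
    refine .of_hasDerivWithinAt hA0.continuousOn (fun t x hx => ?_)
      (ParamContDiff.piecewise hclopen (.const 1) ((hexp hBa ih.2).reparam hpred))
    by_cases ht : t = 0
    · subst ht
      have h1 : A 0 = f 1 := withLimit_natCast 0
      rw [piecewise_eq_of_mem _ _ _ (mem_singleton _), h1]
      exact (hasDerivWithinAt_id x _).congr hf.1 (hf.1 x hx)
    · rw [piecewise_eq_of_notMem _ _ _ (by simpa using ht)]
      exact (hBA t ht).2 x hx

end IsPicardIteration

/-! ### Convergence of the iteration and the formal solution -/

theorem mainTheorem4 :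
    -- the iteration is well defined on `[0, ∞)`
    (∃ f : ℕ → ℝ → ℝ, IsPicardIteration f) ∧
    (∀ f g : ℕ → ℝ → ℝ, IsPicardIteration f → IsPicardIteration g →
      ∀ n ≥ 1, EqOn (f n) (g n) (Ici 0)) ∧
    -- there is exactly one formal solution
    (∃! F : PowerSeries ℝ, IsFormalSolution F) ∧
    ∀ f : ℕ → ℝ → ℝ, IsPicardIteration f →
      (∀ n ≥ 1, BijOn (f n) (Ici 0) (Ici 0) ∧ StrictMonoOn (f n) (Ici 0) ∧
        ConvexOn ℝ (Ici 0) (f n) ∧ ContDiffOn ℝ ∞ (f n) (Ici 0)) ∧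
      -- monotonicity and ordering of the odd and even subsequences
      (∀ x ∈ Ici (0 : ℝ), Monotone (fun k : ℕ => f (2 * k + 1) x)) ∧
      (∀ x ∈ Ici (0 : ℝ), Antitone (fun k : ℕ => f (2 * k + 2) x)) ∧
      (∀ k : ℕ, ∀ x > (0 : ℝ), f (2 * k + 1) x < f (2 * k + 2) x) ∧
      ∃ fm fp : ℝ → ℝ,
        -- convergence, locally uniformly and locally in `C^∞`
        TendstoLocallyUniformlyOn (fun k : ℕ => f (2 * k + 1)) fm atTop (Ici 0) ∧
        TendstoLocallyUniformlyOn (fun k : ℕ => f (2 * k + 2)) fp atTop (Ici 0) ∧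
        TendstoLocallySmooth (fun k : ℕ => f (2 * k + 1)) fm ∧
        TendstoLocallySmooth (fun k : ℕ => f (2 * k + 2)) fp ∧
        -- properties of the limits
        ContDiffOn ℝ ∞ fm (Ici 0) ∧ ContDiffOn ℝ ∞ fp (Ici 0) ∧
        StrictMonoOn fm (Ici 0) ∧ StrictMonoOn fp (Ici 0) ∧
        ConvexOn ℝ (Ici 0) fm ∧ ConvexOn ℝ (Ici 0) fp ∧
        (∀ x ∈ Ici (0 : ℝ), fm x ≤ fp x) ∧
        -- the limits form an orbit of order at most two
        BijOn fm (Ici 0) (Ici 0) ∧ BijOn fp (Ici 0) (Ici 0) ∧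
        IsPicardImage fm fp ∧ IsPicardImage fp fm ∧
        -- the Taylor coefficients at zero are those of the formal solution
        ∀ F : PowerSeries ℝ, IsFormalSolution F → ∀ m : ℕ,
          iteratedDerivWithin m fm (Ici 0) 0 / (m.factorial : ℝ) = PowerSeries.coeff m F ∧
          iteratedDerivWithin m fp (Ici 0) 0 / (m.factorial : ℝ) = PowerSeries.coeff m F := by
  -- Every iteration has limits whose Taylor series form a formal orbit; existence of the formal
  -- solution is read off from the iteration itself.
  have key : ∀ f, IsPicardIteration f → ∃ fm fp : ℝ → ℝ,
      (∀ x ∈ Ici (0 : ℝ), Tendsto (fun k : ℕ => f (2 * k + 1) x) atTop (𝓝 (fm x))) ∧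
      (∀ x ∈ Ici (0 : ℝ), Tendsto (fun k : ℕ => f (2 * k + 2) x) atTop (𝓝 (fp x))) ∧
      Admissible fm ∧ Admissible fp ∧
      IsFormalPicardImage (taylorSeries fm) (taylorSeries fp) ∧
      IsFormalPicardImage (taylorSeries fp) (taylorSeries fm) := by
    intro f hf
    obtain ⟨fm, hm⟩ := hf.exists_tendsto_odd
    obtain ⟨fp, hp⟩ := hf.exists_tendsto_even
    have hma : Admissible fm := .of_tendsto (fun k => hf.admissible (2 * k)) hm
    have hpa : Admissible fp := .of_tendsto (fun k => hf.admissible (2 * k + 1)) hp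
    have hsm := (tendstoLocallySmooth_of_withLimit fun m => (hf.paramContDiff hm hp m).1).2.1
    have hsp := (tendstoLocallySmooth_of_withLimit fun m => (hf.paramContDiff hm hp m).2).2.1
    exact ⟨fm, fp, hm, hp, hma, hpa,
      (hf.isPicardImage_limit_even hm hp).taylorSeries hma hsm,
      (hf.isPicardImage_limit_odd hm hp).taylorSeries hpa hsp⟩
  refine ⟨exists_isPicardIteration, fun f g hf hg n hn => ?_, ?_, fun f hf => ?_⟩
  · obtain ⟨n, rfl⟩ : ∃ j, n = j + 1 := ⟨n - 1, by omega⟩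
    exact hf.eqOn hg n
  · obtain ⟨f, hf⟩ := exists_isPicardIteration
    obtain ⟨fm, fp, -, -, -, -, hmp, hpm⟩ := key f hf
    have heq := (hmp.orbit_unique hpm hpm hmp).1
    rw [← heq] at hmp
    refine ⟨_, isFormalSolution_iff.2 hmp, fun F hF => ?_⟩
    have hF := isFormalSolution_iff.1 hF
    exact (hF.orbit_unique hF hmp hmp).1
  obtain ⟨fm, fp, hm, hp, hma, hpa, hmp, hpm⟩ := key f hf
  have hAB := hf.paramContDiff hm hp
  have hsm := tendstoLocallySmooth_of_withLimit fun m => (hAB m).1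
  have hsp := tendstoLocallySmooth_of_withLimit fun m => (hAB m).2
  have him := hf.isPicardImage_limit_odd hm hp
  have hip := hf.isPicardImage_limit_even hm hp
  refine ⟨fun n hn => ?_, fun x hx => hf.monotone_odd hx, fun x hx => hf.antitone_even hx,
    fun k => (hf.lt_and_lt k).1, fm, fp, ?_, ?_, hsm, hsp, hsm.2.1, hsp.2.1, hma.strictMonoOn,
    hpa.strictMonoOn, him.convexOn hpa, hip.convexOn hma, fun x hx => ?_, hma.bijOn, hpa.bijOn,
    hip, him, fun F hF m => ?_⟩
  · obtain ⟨n, rfl⟩ : ∃ j, n = j + 1 := ⟨n - 1, by omega⟩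
    refine ⟨(hf.admissible n).bijOn, (hf.admissible n).strictMonoOn, hf.convexOn n, ?_⟩
    obtain ⟨k, rfl | rfl⟩ := n.even_or_odd'
    · exact hsm.1 k
    · exact hsp.1 k
  · simpa [iteratedDerivWithin_zero] using hsm.2.2 0
  · simpa [iteratedDerivWithin_zero] using hsp.2.2 0
  · refine le_of_tendsto_of_tendsto' (hm x hx) (hp x hx) fun k => ?_
    rcases eq_or_lt_of_le (mem_Ici.1 hx) with rfl | h
    · rw [(hf.admissible _).1, (hf.admissible _).1]
    · exact ((hf.lt_and_lt k).1 x h).le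
  · rw [isFormalSolution_iff] at hF
    obtain ⟨h1, h2⟩ := hF.orbit_unique hF hmp hpm
    exact ⟨by rw [h1]; simp [taylorSeries], by rw [h2]; simp [taylorSeries]⟩
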